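/- Let $k$ be a field and $d\ge 0$. Order $\mathbb{R}^d$ by the product order. A ($d$-parameter persistence) module is a functor $M$ from the poset $\mathbb{R}^d$ to $k$-vector spaces; it is pfd if every $M_p$ is finite-dimensional, and $\operatorname{supdim} M=\sup_p\dim M_p\in\{0,1,\dots,\infty\}$. For $\varepsilon\in\mathbb{R}$ the shift $M(\varepsilon)$ is given by $M(\varepsilon)_p=M_{p+(\varepsilon,\dots,\varepsilon)}$, and for $\varepsilon\ge 0$ the structure maps of $M$ give $M_{0\to\varepsilon}\colon M\to M(\varepsilon)$. For an upward closed set $U\subseteq\mathbb{R}^d$, the upset module of $U$ is $k$ at $p\in U$, $0$ at $p\notin U$, with identity maps on $k$ within $U$. A module is upset-decomposable if it is isomorphic to a direct sum of upset modules. *Bottleneck distance.* Modules $M,N$ are $\varepsilon$-interleaved if there are morphisms $\varphi\colon M\to N(\varepsilon)$ and $\psi\colon N\to M(\varepsilon)$ with $\psi(\varepsilon)\circ\varphi=M_{0\to2\varepsilon}$ and $\varphi(\varepsilon)\circ\psi=N_{0\to2\varepsilon}$. The barcode $B(M)$ of a pfd module $M$ is the multiset of isomorphism classes of the summands in a decomposition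 of $M$ into nonzero indecomposable modules. An $\varepsilon$-matching between $M$ and $N$ is a bijection $\sigma$ from a sub-multiset of $B(M)$ to a sub-multiset of $B(N)$ such that each matched $Q$ is $\varepsilon$-interleaved with $\sigma(Q)$ and each unmatched element of $B(M)$ or $B(N)$ is $\varepsilon$-interleaved with the zero module. Then $d_B(M,N)\in[0,\infty]$ is the infimum of all $\varepsilon\ge0$ for which there is an $\varepsilon$-matching between $M$ and $N$. *Pruning distance.* For $\varepsilon\ge0$, let $I$ be the largest submodule of $M$ with $f(I)\subseteq M_{0\to2\varepsilon}(I)$ for every morphism $f\colon M\to M(2\varepsilon)$, and let $K$ be the smallest submodule of $I$ with $I_{0\to2\varepsilon}^{-1}(f(K))\subseteq K$ for every morphism $f\colon M\to M(2\varepsilon)$. The $\varepsilon$-pruning of $M$ is $\operatorname{Pru}_\varepsilon(M)=(I/K)(-\varepsilon)$. A subquotient of a module $X$ is a module isomorphic to $Y/Z$ for submodules $Z\subseteq Y\subseteq X$; an $\infty$-refinement of $X\cong\bigoplus_{i}X_i$, with all $X_i$ nonzero and indecomposable, is a module isomorphic to some $\bigoplus_{i}Y_i$ where each $Y_i$ is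 a subquotient of $X_i$. Then $d_P(M,N)\in[0,\infty]$ is the infimum of all $\varepsilon\ge0$ such that, for every $\delta\ge0$, $\operatorname{Pru}_{\varepsilon+\delta}(M)$ is an $\infty$-refinement of $\operatorname{Pru}_\delta(N)$ and $\operatorname{Pru}_{\varepsilon+\delta}(N)$ is an $\infty$-refinement of $\operatorname{Pru}_\delta(M)$. **Theorem.** Let $M$ and $N$ be pfd upset-decomposable modules over $\mathbb{R}^d$ with $r=\operatorname{supdim}M$, $1\le r<\infty$, and $\operatorname{supdim}N<\infty$. Then $$d_B(M,N)\le(2r-1)\,d_P(M,N).$$ -/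

import Mathlib

open CategoryTheory Limits
open scoped NNReal ENNReal DirectSum ZeroObject

universe u

noncomputable section

/-! ## The poset `ℝ^d` and its shift functions -/

/-- `ℝ^d` with the product order. (A type synonym of `Fin d → ℝ`, so that the only category
structure on it is the one of the poset.) -/
def RPow (d : ℕ) : Type := Fin d → ℝ

instance (d : ℕ) : PartialOrder (RPow d) := inferInstanceAs (PartialOrder (Fin d → ℝ))

/-- `p ↦ p + (ε, …, ε)`. -/
def RPow.shift {d : ℕ} (ε : ℝ) (p : RPow d) : RPow d := fun i => p i + ε

theorem RPow.shift_mono {d : ℕ} (ε : ℝ) : Monotone (RPow.shift (d := d) ε) :=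
  fun _ _ h i => add_le_add (h i) le_rfl

theorem RPow.le_shift {d : ℕ} (ε : ℝ≥0) (p : RPow d) : p ≤ RPow.shift (ε : ℝ) p :=
  fun i => le_add_of_nonneg_right (a := p i) ε.coe_nonneg

/-! ## Persistence modules -/

/-- `d`-parameter persistence modules over the field `k`: functors from the poset `ℝ^d` to
`k`-vector spaces. -/
abbrev PersMod (k : Type u) [Field k] (d : ℕ) := RPow d ⥤ ModuleCat.{u} k

namespace PersMod

variable {k : Type u} [Field k] {d : ℕ}

/-- The `ε`-shift `M(ε)`. -/
abbrev shift (ε : ℝ) (M : PersMod k d) : PersMod k d where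
  obj p := M.obj (RPow.shift ε p)
  map f := M.map (homOfLE (RPow.shift_mono ε (leOfHom f)))
  map_id p := M.map_id _
  map_comp f g := by
    rw [← M.map_comp]
    rfl

/-- The morphism `M_{0 → ε} : M → M(ε)` for `ε ≥ 0`. -/
def toShift (ε : ℝ≥0) (M : PersMod k d) : M ⟶ M.shift (ε : ℝ) where
  app p := M.map (homOfLE (RPow.le_shift ε p))
  naturality p q f := by
    rw [← M.map_comp, ← M.map_comp]
    rfl

/-- The direct sum of a family of modules, formed pointwise. -/
def directSum {I : Type u} (P : I → PersMod k d) : PersMod k d where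
  obj p := ModuleCat.of k (⨁ i, (P i).obj p)
  map f := ModuleCat.ofHom (DirectSum.lmap fun i => ((P i).map f).hom)
  map_id p := by
    ext x
    simp
  map_comp f g := by
    ext x
    simp

/-- Pointwise finite-dimensional modules. -/
def IsPFD (M : PersMod k d) : Prop := ∀ p, FiniteDimensional k (M.obj p)

/-- `sup_p dim M_p ∈ {0, 1, …, ∞}`. -/
def supdim (M : PersMod k d) : ℕ∞ := ⨆ p, Cardinal.toENat (Module.rank k (M.obj p))

/-! ## Upset modules -/

open Classical in
/-- `k` if `p ∈ U`, and `0` otherwise, both realised as subspaces of `k`. -/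
def upsetFibre (k : Type u) [Field k] (U : Set (RPow d)) (p : RPow d) : Submodule k k :=
  if p ∈ U then ⊤ else ⊥

theorem upsetFibre_mono {U : Set (RPow d)} (hU : IsUpperSet U) :
    Monotone (upsetFibre k U) := by
  intro p q h
  unfold upsetFibre
  by_cases hp : p ∈ U
  · rw [if_pos hp, if_pos (hU h hp)]
  · rw [if_neg hp]
    exact bot_le

/-- The upset module of an upset `U`: it is `k` on `U` and `0` outside `U`, and the structure
map `p → q` is the identity of `k` for `p ∈ U` (and `0` for `p ∉ U`). -/
def upsetModule (k : Type u) [Field k] (U : Set (RPow d)) (hU : IsUpperSet U) :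
    PersMod k d where
  obj p := ModuleCat.of k (upsetFibre k U p)
  map f := ModuleCat.ofHom (Submodule.inclusion (upsetFibre_mono hU (leOfHom f)))

/-- A module isomorphic to a direct sum of upset modules. -/
def IsUpsetDecomposable (M : PersMod k d) : Prop :=
  ∃ (I : Type u) (U : I → Set (RPow d)) (hU : ∀ i, IsUpperSet (U i)),
    Nonempty (M ≅ directSum fun i => upsetModule k (U i) (hU i))

/-! ## Barcodes and the bottleneck distance -/

/-- `M` and `N` are `ε`-interleaved: there are `φ : M → N(ε)` and `ψ : N → M(ε)` with
`ψ(ε) ∘ φ = M_{0 → 2ε}` and `φ(ε) ∘ ψ = N_{0 → 2ε}`. (At `p`, both sides of the first equation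
are maps from `M_p` to `M_{p + 2ε}`, here written as `M_{(p + ε) + ε}`.) -/
def Interleaved (ε : ℝ≥0) (M N : PersMod k d) : Prop :=
  ∃ (φ : M ⟶ N.shift (ε : ℝ)) (ψ : N ⟶ M.shift (ε : ℝ)),
    (∀ p, φ.app p ≫ ψ.app (RPow.shift (ε : ℝ) p) =
      M.map (homOfLE ((RPow.le_shift ε p).trans (RPow.le_shift ε _)))) ∧
    (∀ p, ψ.app p ≫ φ.app (RPow.shift (ε : ℝ) p) =
      N.map (homOfLE ((RPow.le_shift ε p).trans (RPow.le_shift ε _))))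

/-- The family `P` is a barcode of `M`: each `P i` is nonzero and indecomposable
(`CategoryTheory.Indecomposable` includes nonzero), and `M ≅ ⨁ P i`. For a pfd module, a barcode
exists and is unique up to reindexing and isomorphism. -/
def IsBarcode {I : Type u} (P : I → PersMod k d) (M : PersMod k d) : Prop :=
  (∀ i, Indecomposable (P i)) ∧ Nonempty (M ≅ directSum P)

/-- There is an `ε`-matching between (the barcodes of) `M` and `N`: a bijection `σ` between a
part `A` of the barcode of `M` and a part `B` of the barcode of `N` such that matched
indecomposables are `ε`-interleaved and unmatched ones are `ε`-interleaved with zero. -/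
def HasMatching (ε : ℝ≥0) (M N : PersMod k d) : Prop :=
  ∃ (I J : Type u) (P : I → PersMod k d) (Q : J → PersMod k d),
    IsBarcode P M ∧ IsBarcode Q N ∧
    ∃ (A : Set I) (B : Set J) (σ : A ≃ B),
      (∀ a : A, Interleaved ε (P a) (Q (σ a))) ∧
      (∀ i, i ∉ A → Interleaved ε (P i) 0) ∧
      (∀ j, j ∉ B → Interleaved ε (Q j) 0)

/-- The bottleneck distance, with values in `[0, ∞]`. -/
def bottleneckDist (M N : PersMod k d) : ℝ≥0∞ :=
  ⨅ (ε : ℝ≥0) (_ : HasMatching ε M N), (ε : ℝ≥0∞)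

/-! ## Submodules and prunings -/

/-- Submodules of a persistence module. -/
@[ext]
structure Sub (M : PersMod k d) where
  /-- the subspace at each point -/
  carrier : ∀ p, Submodule k (M.obj p)
  map_mem : ∀ {p q : RPow d} (h : p ≤ q), ∀ x ∈ carrier p, M.map (homOfLE h) x ∈ carrier q

instance (M : PersMod k d) : PartialOrder (Sub M) where
  le S T := ∀ p, S.carrier p ≤ T.carrier p
  le_refl _ _ := le_rfl
  le_trans _ _ _ h h' p := (h p).trans (h' p)
  le_antisymm _ _ h h' := Sub.ext (funext fun p => le_antisymm (h p) (h' p))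

/-- The condition on `I` in the `ε`-pruning: `f(I) ⊆ M_{0 → 2ε}(I)` for all `f : M → M(2ε)`. -/
def PruneUpper (ε : ℝ≥0) {M : PersMod k d} (I : Sub M) : Prop :=
  ∀ (f : M ⟶ M.shift ((2 * ε : ℝ≥0) : ℝ)) (p : RPow d),
    (I.carrier p).map (f.app p).hom ≤ (I.carrier p).map ((M.toShift (2 * ε)).app p).hom

/-- The largest submodule `I` of `M` such that `f(I) ⊆ M_{0 → 2ε}(I)` for all `f : M → M(2ε)`,
as the sum of all of them. -/
def pruneI (ε : ℝ≥0) (M : PersMod k d) : Sub M where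
  carrier p := ⨆ S : {S : Sub M // PruneUpper ε S}, S.1.carrier p
  map_mem {p q} h x hx := by
    have key : (⨆ S : {S : Sub M // PruneUpper ε S}, S.1.carrier p) ≤
        (⨆ S : {S : Sub M // PruneUpper ε S}, S.1.carrier q).comap (M.map (homOfLE h)).hom :=
      iSup_le fun S y hy =>
        Submodule.mem_iSup_of_mem (p := fun S : {S : Sub M // PruneUpper ε S} => S.1.carrier q)
          S (S.1.map_mem h y hy)
    exact key hx

theorem pruneI_isGreatest (ε : ℝ≥0) (M : PersMod k d) :
    IsGreatest {S : Sub M | PruneUpper ε S} (pruneI ε M) := by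
  constructor
  · intro f p
    change Submodule.map _ (⨆ S : {S : Sub M // PruneUpper ε S}, S.1.carrier p) ≤
      Submodule.map _ (⨆ S : {S : Sub M // PruneUpper ε S}, S.1.carrier p)
    rw [Submodule.map_iSup, Submodule.map_iSup]
    exact iSup_mono fun S => S.2 f p
  · intro S hS p
    exact le_iSup (fun S : {S : Sub M // PruneUpper ε S} => S.1.carrier p) ⟨S, hS⟩

/-- The condition on a submodule `K` of `I` in the `ε`-pruning, for `I = pruneI ε M`:
`I_{0 → 2ε}⁻¹(f(K)) ⊆ K` for all `f : M → M(2ε)`. -/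
def PruneLower (ε : ℝ≥0) {M : PersMod k d} (K : Sub M) : Prop :=
  K ≤ pruneI ε M ∧
  ∀ (f : M ⟶ M.shift ((2 * ε : ℝ≥0) : ℝ)) (p : RPow d), ∀ x ∈ (pruneI ε M).carrier p,
    (M.toShift (2 * ε)).app p x ∈ (K.carrier p).map (f.app p).hom → x ∈ K.carrier p

/-- The smallest submodule `K` of `I` such that `I_{0 → 2ε}⁻¹(f(K)) ⊆ K` for all
`f : M → M(2ε)`, as the intersection of all of them. -/
def pruneK (ε : ℝ≥0) (M : PersMod k d) : Sub M where
  carrier p := ⨅ S : {S : Sub M // PruneLower ε S}, S.1.carrier p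
  map_mem {p q} h x hx := by
    rw [Submodule.mem_iInf] at hx ⊢
    exact fun S => S.1.map_mem h x (hx S)

theorem pruneK_isLeast (ε : ℝ≥0) (M : PersMod k d) :
    IsLeast {S : Sub M | PruneLower ε S} (pruneK ε M) := by
  have hI : PruneLower ε (pruneI ε M) := ⟨le_rfl, fun _ _ x hx _ => hx⟩
  have hle : ∀ S : Sub M, PruneLower ε S → pruneK ε M ≤ S := fun S hS p =>
    iInf_le (fun S : {S : Sub M // PruneLower ε S} => S.1.carrier p) ⟨S, hS⟩
  refine ⟨⟨hle _ hI, fun f p x hx hfx => ?_⟩, fun S hS => hle S hS⟩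
  change x ∈ ⨅ S : {S : Sub M // PruneLower ε S}, S.1.carrier p
  rw [Submodule.mem_iInf]
  intro S
  exact S.2.2 f p x hx (Submodule.map_mono (hle S.1 S.2 p) hfx)

/-- The quotient `I / K` of two submodules of `M`. (At `p` it is `I_p / (I_p ∩ K_p)`, which is
`I_p / K_p` for `K ⊆ I`.) -/
def subquot {M : PersMod k d} (I K : Sub M) : PersMod k d where
  obj p := ModuleCat.of k (I.carrier p ⧸ (K.carrier p).submoduleOf (I.carrier p))
  map {p q} f := ModuleCat.ofHom <|
    Submodule.mapQ _ _
      ((M.map f).hom.restrict fun x hx => I.map_mem (leOfHom f) x hx)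
      (fun x hx => K.map_mem (leOfHom f) (x : M.obj p) hx)
  map_id p := by
    ext x
    simp [LinearMap.restrict_apply]
  map_comp f g := by
    ext x
    simp only [Functor.map_comp, ModuleCat.hom_ofHom, ModuleCat.hom_comp, LinearMap.comp_apply,
      Submodule.mkQ_apply]
    rfl

/-- The `ε`-pruning `Pru_ε(M) = (I / K)(-ε)`. -/
def pruning (ε : ℝ≥0) (M : PersMod k d) : PersMod k d :=
  (subquot (pruneI ε M) (pruneK ε M)).shift (-(ε : ℝ))

/-! ## The pruning distance -/

/-- `N` is a subquotient of `M`. -/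
def IsSubquotient (N M : PersMod k d) : Prop :=
  ∃ I K : Sub M, K ≤ I ∧ Nonempty (N ≅ subquot I K)

/-- `N` is an `∞`-refinement of `M`: for `M ≅ ⨁ M_i` with each `M_i` indecomposable, `N` is
isomorphic to some `⨁ N_i` with each `N_i` a subquotient of `M_i`. -/
def IsInfRefinement (N M : PersMod k d) : Prop :=
  ∃ (I : Type u) (P Q : I → PersMod k d), IsBarcode P M ∧
    (∀ i, IsSubquotient (Q i) (P i)) ∧ Nonempty (N ≅ directSum Q)

/-- The pruning distance, with values in `[0, ∞]`. -/
def pruningDist (M N : PersMod k d) : ℝ≥0∞ :=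
  ⨅ (ε : ℝ≥0) (_ : ∀ δ : ℝ≥0,
      IsInfRefinement (pruning (ε + δ) M) (pruning δ N) ∧
      IsInfRefinement (pruning (ε + δ) N) (pruning δ M)), (ε : ℝ≥0∞)

end PersMod

end

/-! ## Upper sets of `ℝ^d` -/

/-! Finitely many nonempty upsets of `ℝ^d` have a common point, so an upset-decomposable module of
supdim at most `r` has at most `r` nonzero summands `U a` (`exists_upsetChart`). Its structure maps
are injective, so `K = 0` in the pruning, and `I` is the sum of the upset modules of `pruneUpset ε U
a`: pruning only shrinks and shifts each upset (`UpsetChart.prune`).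

Let `ε` be admissible for the pruning distance. The case `δ = 0`, linear independence and Hall's
theorem give injections `σ`, `τ` between the two index sets such that each shrunken `U a`, shifted
by `ε`, lies in `V (σ a)`, and symmetrically for `τ`
(`exists_injective_of_pruning_isInfRefinement`). Both are bijections, and `σ` is the matching.

To bound its cost, let `E m` be the set of those `b` for which `U a` lies in `U b` up to a shift by
`2mε`. If `E m` is closed under steps of length `2ε`, then `U a` lies in the shrunken `U a` up to
`2mε`, hence in `V (σ a)` up to `(2m+1)ε`. If it is not closed, `E (m+1)` is strictly larger; so `m
= r - 1` suffices, with cost `(2r-1)ε`. For the reverse inclusion the same growth starts at `V (σ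
a)` and alternates between the two sides along `τ` and `σ`, with no further loss
(`mem_of_double_growth`). -/

instance (d : ℕ) : IsDirectedOrder (RPow d) :=
  ⟨fun p q => ⟨fun i => max (p i) (q i), fun _ => le_max_left _ _, fun _ => le_max_right _ _⟩⟩

instance (d : ℕ) : Nonempty (RPow d) := ⟨fun _ => 0⟩

namespace RPow

variable {d : ℕ}

theorem shift_shift (a b : ℝ) (p : RPow d) : shift a (shift b p) = shift (b + a) p :=
  funext fun i => add_assoc (p i) b a

theorem shift_zero (p : RPow d) : shift 0 p = p := funext fun i => add_zero (p i)

theorem shift_le_shift {a b : ℝ} (h : a ≤ b) (p : RPow d) : shift a p ≤ shift b p :=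
  fun i => add_le_add_right h (p i)

theorem exists_forall_mem {A : Type*} [Finite A] {U : A → Set (RPow d)}
    (hU : ∀ a, IsUpperSet (U a)) (hne : ∀ a, (U a).Nonempty) : ∃ p, ∀ a, p ∈ U a := by
  obtain ⟨p, hp⟩ := Finite.exists_le fun a => (hne a).some
  exact ⟨p, fun a => hU a (hp a) (hne a).some_mem⟩

end RPow

noncomputable section

namespace PersMod

variable {k : Type u} [Field k] {d : ℕ} {M N : PersMod k d}

theorem app_map (f : M ⟶ N) {p q : RPow d} (h : p ≤ q) (x : M.obj p) :
    f.app q (M.map (homOfLE h) x) = N.map (homOfLE h) (f.app p x) :=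
  NatTrans.naturality_apply f (homOfLE h) x

/-! ## Coordinates on direct sums of upset modules -/

/-- Coordinates identifying `M` with the direct sum of the upset modules of the sets `U a`, where
`M_p` becomes the space of the vectors supported on `{a | p ∈ U a}`. -/
structure UpsetChart (M : PersMod k d) {A : Type*} (U : A → Set (RPow d)) where
  /-- the coordinates at each point -/
  coord : ∀ p, M.obj p →ₗ[k] (A → k)
  coord_injective : ∀ p, Function.Injective (coord p)
  coord_map : ∀ {p q : RPow d} (h : p ≤ q) (x : M.obj p),
    coord q (M.map (homOfLE h) x) = coord p x
  exists_coord_eq_iff : ∀ p v, (∃ x, coord p x = v) ↔ ∀ a, v a ≠ 0 → p ∈ U a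

namespace UpsetChart

variable {A B : Type*} {U : A → Set (RPow d)} {V : B → Set (RPow d)}

theorem mem_of_coord_ne_zero (c : UpsetChart M U) {p : RPow d} {x : M.obj p} {a : A}
    (h : c.coord p x a ≠ 0) : p ∈ U a :=
  (c.exists_coord_eq_iff p _).1 ⟨x, rfl⟩ a h

/-- The element with given coordinates. -/
def elem (c : UpsetChart M U) {p : RPow d} (v : A → k) (hv : ∀ a, v a ≠ 0 → p ∈ U a) : M.obj p :=
  ((c.exists_coord_eq_iff p v).2 hv).choose

@[simp]
theorem coord_elem (c : UpsetChart M U) {p : RPow d} (v : A → k)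
    (hv : ∀ a, v a ≠ 0 → p ∈ U a) : c.coord p (c.elem v hv) = v :=
  ((c.exists_coord_eq_iff p v).2 hv).choose_spec

theorem exists_coord_single [DecidableEq A] (c : UpsetChart M U) {p : RPow d} {a : A}
    (hp : p ∈ U a) (t : k) : ∃ x, c.coord p x = Pi.single a t := by
  refine (c.exists_coord_eq_iff p _).2 fun b hb => ?_
  obtain rfl : b = a := by
    by_contra h
    exact hb (by simp [h])
  exact hp

theorem isUpperSet (c : UpsetChart M U) (a : A) : IsUpperSet (U a) := by
  classical
  intro p q h hp
  obtain ⟨x, hx⟩ := c.exists_coord_single hp 1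
  refine c.mem_of_coord_ne_zero (x := M.map (homOfLE h) x) (a := a) ?_
  rw [c.coord_map, hx, Pi.single_eq_same]
  exact one_ne_zero

theorem map_injective (c : UpsetChart M U) {p q : RPow d} (h : p ≤ q) :
    Function.Injective (M.map (homOfLE h)) := fun x y hxy =>
  c.coord_injective p (by rw [← c.coord_map h, hxy, c.coord_map])

theorem surjective (c : UpsetChart M U) {p : RPow d} (hp : ∀ a, p ∈ U a) :
    Function.Surjective (c.coord p) := fun v => ⟨c.elem v fun a _ => hp a, c.coord_elem _ _⟩

/-- Transport of a chart along an isomorphism. -/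
def ofIso (c : UpsetChart M U) (e : N ≅ M) : UpsetChart N U where
  coord p := (c.coord p).comp (e.hom.app p).hom
  coord_injective p := by
    have : Function.Injective (e.hom.app p).hom :=
      (ModuleCat.mono_iff_injective (e.hom.app p)).1 inferInstance
    exact (c.coord_injective p).comp this
  coord_map {p q} h x := by
    change c.coord q (e.hom.app q (N.map (homOfLE h) x)) = c.coord p (e.hom.app p x)
    rw [app_map, c.coord_map]
  exists_coord_eq_iff p v := by
    rw [← c.exists_coord_eq_iff p v]
    constructor
    · rintro ⟨x, hx⟩
      exact ⟨_, hx⟩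
    · rintro ⟨x, hx⟩
      refine ⟨e.inv.app p x, ?_⟩
      change c.coord p (e.hom.app p (e.inv.app p x)) = v
      rw [← ConcreteCategory.comp_apply, Iso.inv_hom_id_app]
      exact hx

/-- The chart of a shift. -/
def shift (c : UpsetChart M U) (ε : ℝ) :
    UpsetChart (M.shift ε) fun a => RPow.shift ε ⁻¹' U a where
  coord p := c.coord (RPow.shift ε p)
  coord_injective _ := c.coord_injective _
  coord_map h x := c.coord_map (RPow.shift_mono ε h) x
  exists_coord_eq_iff _ v := c.exists_coord_eq_iff _ v

/-- The linear map `M_p → N_p` with a given coordinate expression. -/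
def linearAt (c : UpsetChart M U) (c' : UpsetChart N V) (T : (A → k) →ₗ[k] (B → k)) (p : RPow d)
    (hT : ∀ v : A → k, (∀ a, v a ≠ 0 → p ∈ U a) → ∀ b, T v b ≠ 0 → p ∈ V b) :
    M.obj p →ₗ[k] N.obj p where
  toFun x := c'.elem (T (c.coord p x)) (hT _ fun _ => c.mem_of_coord_ne_zero)
  map_add' x y := c'.coord_injective p (by simp)
  map_smul' t x := c'.coord_injective p (by simp)

theorem coord_linearAt (c : UpsetChart M U) (c' : UpsetChart N V) (T : (A → k) →ₗ[k] (B → k))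
    (p : RPow d) (hT : ∀ v : A → k, (∀ a, v a ≠ 0 → p ∈ U a) → ∀ b, T v b ≠ 0 → p ∈ V b)
    (x : M.obj p) : c'.coord p (c.linearAt c' T p hT x) = T (c.coord p x) :=
  c'.coord_elem _ (hT _ fun _ => c.mem_of_coord_ne_zero)

/-- The morphism given by a linear map of coordinates that respects supports. -/
def homOfLinear (c : UpsetChart M U) (c' : UpsetChart N V) (T : (A → k) →ₗ[k] (B → k))
    (hT : ∀ p v, (∀ a, v a ≠ 0 → p ∈ U a) → ∀ b, T v b ≠ 0 → p ∈ V b) : M ⟶ N where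
  app p := ModuleCat.ofHom (c.linearAt c' T p (hT p))
  naturality p q f := by
    ext x
    refine c'.coord_injective q ?_
    change c'.coord q (c.linearAt c' T q (hT q) (M.map (homOfLE (leOfHom f)) x)) =
      c'.coord q (N.map (homOfLE (leOfHom f)) (c.linearAt c' T p (hT p) x))
    rw [coord_linearAt, c.coord_map, c'.coord_map, coord_linearAt]

@[simp]
theorem coord_homOfLinear (c : UpsetChart M U) (c' : UpsetChart N V) (T : (A → k) →ₗ[k] (B → k))
    (hT : ∀ p v, (∀ a, v a ≠ 0 → p ∈ U a) → ∀ b, T v b ≠ 0 → p ∈ V b) (p : RPow d)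
    (x : M.obj p) : c'.coord p ((c.homOfLinear c' T hT).app p x) = T (c.coord p x) :=
  c.coord_linearAt c' T p (hT p) x

theorem hom_ext (c : UpsetChart N V) {f g : M ⟶ N}
    (h : ∀ p x, c.coord p (f.app p x) = c.coord p (g.app p x)) : f = g := by
  ext p x
  exact c.coord_injective p (h p x)

/-- Modules with charts for the same sets are isomorphic. -/
def iso (c : UpsetChart M U) (c' : UpsetChart N U) : M ≅ N where
  hom := c.homOfLinear c' LinearMap.id fun _ _ h => h
  inv := c'.homOfLinear c LinearMap.id fun _ _ h => h
  hom_inv_id := c.hom_ext fun p x => by simp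
  inv_hom_id := c'.hom_ext fun p x => by simp

/-- In coordinates, a morphism is a single linear map. -/
theorem exists_linear [Finite A] (c : UpsetChart M U) (c' : UpsetChart N V)
    (hU : ∀ a, (U a).Nonempty) (f : M ⟶ N) :
    ∃ T : (A → k) →ₗ[k] (B → k), ∀ p x, c'.coord p (f.app p x) = T (c.coord p x) := by
  obtain ⟨o, ho⟩ := RPow.exists_forall_mem c.isUpperSet hU
  let e := LinearEquiv.ofBijective (c.coord o) ⟨c.coord_injective o, c.surjective ho⟩
  refine ⟨(c'.coord o).comp ((f.app o).hom.comp e.symm.toLinearMap), fun p x => ?_⟩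
  -- Over `o` every coordinate vector occurs. The points `p` and `o` are compared at a common upper
  -- bound, since structure maps preserve coordinates.
  obtain ⟨q, hpq, hoq⟩ := exists_ge_ge p o
  have hx : M.map (homOfLE hoq) (e.symm (c.coord p x)) = M.map (homOfLE hpq) x := by
    refine c.coord_injective q ?_
    rw [c.coord_map, c.coord_map]
    exact e.apply_symm_apply _
  have h := congrArg (fun y => c'.coord q (f.app q y)) hx
  simp only [app_map, c'.coord_map] at h
  exact h.symm

/-- The basis vector at `a` exists over every point of `U a`, and its image can have a nonzero
`b`-coordinate only over `V b`. -/
theorem subset_of_linear [DecidableEq A] (c : UpsetChart M U) (c' : UpsetChart N V) {f : M ⟶ N}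
    {T : (A → k) →ₗ[k] (B → k)} (hT : ∀ p x, c'.coord p (f.app p x) = T (c.coord p x))
    {a : A} {b : B} (h : T (Pi.single a 1) b ≠ 0) : U a ⊆ V b := by
  intro p hp
  obtain ⟨x, hx⟩ := c.exists_coord_single hp 1
  refine c'.mem_of_coord_ne_zero (x := f.app p x) ?_
  rwa [hT, hx]

open Classical in
/-- The morphism that has a single nonzero matrix entry. -/
def elementary (c : UpsetChart M U) (c' : UpsetChart N V) {a : A} {b : B} (h : U a ⊆ V b) : M ⟶ N :=
  c.homOfLinear c' ((LinearMap.single k (fun _ : B => k) b).comp (LinearMap.proj a)) <| by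
    intro p v hv i hi
    obtain rfl : i = b := by
      by_contra hib
      exact hi (by simp [hib])
    refine h (hv a fun h0 => hi ?_)
    simp [h0]

theorem coord_elementary [DecidableEq B] (c : UpsetChart M U) (c' : UpsetChart N V) {a : A} {b : B}
    (h : U a ⊆ V b) (p : RPow d) (x : M.obj p) :
    c'.coord p ((c.elementary c' h).app p x) = Pi.single b (c.coord p x a) := by
  rw [elementary, coord_homOfLinear]
  ext i
  simp [Pi.single_apply]

end UpsetChart

end PersMod

end

noncomputable section

namespace PersMod

variable {k : Type u} [Field k] {d : ℕ} {M N : PersMod k d}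

/-! ## The pruning of a direct sum of upset modules -/

theorem exists_ne_zero_of_linear {A B : Type*} [Finite A] [DecidableEq A]
    (T : (A → k) →ₗ[k] (B → k)) {v : A → k} {b : B} (h : T v b ≠ 0) :
    ∃ a, v a ≠ 0 ∧ T (Pi.single a 1) b ≠ 0 := by
  have := Fintype.ofFinite A
  rw [LinearMap.pi_apply_eq_sum_univ T v, Finset.sum_apply] at h
  obtain ⟨a, -, ha⟩ := Finset.exists_ne_zero_of_sum_ne_zero h
  rw [Pi.smul_apply, smul_eq_mul] at ha
  refine ⟨a, left_ne_zero_of_mul ha, ?_⟩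
  have h1 : (Pi.single a 1 : A → k) = fun i => if a = i then 1 else 0 :=
    funext fun i => by simp [Pi.single_apply, eq_comm]
  rw [h1]
  exact right_ne_zero_of_mul ha

/-- `U a` maps nontrivially to the `2ε`-shift of `U b`. -/
def PruneStep {A : Type*} (ε : ℝ≥0) (U : A → Set (RPow d)) (a b : A) : Prop :=
  U a ⊆ RPow.shift ((2 * ε : ℝ≥0) : ℝ) ⁻¹' U b

/-- The intersection of all `U b` that can be reached from `U a` by steps of length `2ε`. -/
def pruneUpset {A : Type*} (ε : ℝ≥0) (U : A → Set (RPow d)) (a : A) : Set (RPow d) :=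
  {p | ∀ b, Relation.ReflTransGen (PruneStep ε U) a b → p ∈ U b}

theorem pruneUpset_subset {A : Type*} (ε : ℝ≥0) (U : A → Set (RPow d)) (a : A) :
    pruneUpset ε U a ⊆ U a := fun _ hp => hp a .refl

theorem pruneUpset_nonempty {A : Type*} [Finite A] (ε : ℝ≥0) {U : A → Set (RPow d)}
    (hU : ∀ a, IsUpperSet (U a)) (hne : ∀ a, (U a).Nonempty) (a : A) :
    (pruneUpset ε U a).Nonempty := by
  obtain ⟨p, hp⟩ := RPow.exists_forall_mem hU hne
  exact ⟨p, fun b _ => hp b⟩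

namespace UpsetChart

variable {A : Type*} {U : A → Set (RPow d)}

/-- The submodule of the vectors supported on the sets `pruneUpset ε U a`. -/
def pruneSub (c : UpsetChart M U) (ε : ℝ≥0) : Sub M where
  carrier p :=
    { carrier := {x | ∀ a, c.coord p x a ≠ 0 → p ∈ pruneUpset ε U a}
      add_mem' := fun {x y} hx hy a h => by
        rw [map_add, Pi.add_apply] at h
        by_cases hxa : c.coord p x a = 0
        · rw [hxa, zero_add] at h
          exact hy a h
        · exact hx a hxa
      zero_mem' := fun a h => absurd (by simp) h
      smul_mem' := fun t x hx a h => by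
        rw [map_smul, Pi.smul_apply] at h
        exact hx a (right_ne_zero_of_smul h) }
  map_mem {p q} h x hx a ha := by
    rw [c.coord_map] at ha
    exact fun b hb => c.isUpperSet b h (hx a ha b hb)

/-- A nonzero matrix entry from `a` to `b` is a step, so whatever is reachable from `b` is reachable
from `a`. Hence `T` of the coordinates of `x` is already supported over `p`, and `f x` is the image
of an element over `p`. -/
theorem pruneUpper_pruneSub [Finite A] (c : UpsetChart M U) (hU : ∀ a, (U a).Nonempty) (ε : ℝ≥0) :
    PruneUpper ε (c.pruneSub ε) := by
  classical
  rintro f p _ ⟨x, hx, rfl⟩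
  obtain ⟨T, hT⟩ := c.exists_linear (c.shift _) hU f
  have key : ∀ b, T (c.coord p x) b ≠ 0 → p ∈ pruneUpset ε U b := by
    intro b hb
    obtain ⟨a, ha, hab⟩ := exists_ne_zero_of_linear T hb
    exact fun i hi => hx a ha i (hi.head (c.subset_of_linear (c.shift _) hT hab))
  have key' : ∀ b, T (c.coord p x) b ≠ 0 → p ∈ U b := fun b hb => pruneUpset_subset ε U b (key b hb)
  refine ⟨c.elem (T (c.coord p x)) key', fun b hb => key b ?_, ?_⟩
  · rwa [c.coord_elem] at hb
  · refine c.coord_injective _ ?_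
    refine (c.coord_map (RPow.le_shift (2 * ε) p) _).trans ?_
    rw [c.coord_elem]
    exact (hT p x).symm

theorem mem_pruneI_iff [Finite A] (c : UpsetChart M U) (hU : ∀ a, (U a).Nonempty) (ε : ℝ≥0) {p : RPow d}
    (x : M.obj p) :
    x ∈ (pruneI ε M).carrier p ↔ ∀ a, c.coord p x a ≠ 0 → p ∈ pruneUpset ε U a := by
  classical
  constructor
  · intro hx a ha b hab
    induction hab using Relation.ReflTransGen.head_induction_on generalizing x with
    | refl => exact c.mem_of_coord_ne_zero ha
    | @head a i hai _ ih =>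
      -- The elementary morphism along the first step yields an element of `I` over the same point
      -- `p` whose `i`-coordinate is that of `x` at `a`; the induction continues from there.
      obtain ⟨y, hy, hyx⟩ := (pruneI_isGreatest ε M).1 (c.elementary (c.shift _) hai) p
        ⟨x, hx, rfl⟩
      refine ih y hy ?_
      have h := congrArg (c.coord _) hyx
      have h1 : c.coord p y = Pi.single i (c.coord p x a) :=
        ((c.coord_map (RPow.le_shift (2 * ε) p) y).symm.trans h).trans
          (c.coord_elementary (c.shift _) hai p x)
      rwa [h1, Pi.single_eq_same]
  · exact fun h => (pruneI_isGreatest ε M).2 (c.pruneUpper_pruneSub hU ε) p h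

/-- Injectivity of the structure maps makes the zero submodule satisfy the condition defining `K`.
-/
theorem pruneK_eq_bot (c : UpsetChart M U) (ε : ℝ≥0) (p : RPow d) :
    (pruneK ε M).carrier p = ⊥ := by
  let S : Sub M := ⟨fun _ => ⊥, fun h x hx => by
    rw [Submodule.mem_bot] at hx ⊢
    rw [hx, map_zero]⟩
  have hS : PruneLower ε S := by
    refine ⟨fun _ => bot_le, fun f p x _ hx => ?_⟩
    have h0 : M.map (homOfLE (RPow.le_shift (2 * ε) p)) x = 0 := by
      obtain ⟨y, hy, hyx⟩ := hx
      rw [(Submodule.mem_bot k).1 hy, map_zero] at hyx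
      exact hyx.symm
    exact (Submodule.mem_bot k).2 (c.map_injective _ (h0.trans (map_zero _).symm))
  exact le_bot_iff.1 ((pruneK_isLeast ε M).2 hS p)

/-- The chart of `I / K` in the definition of the `ε`-pruning. -/
def subquotPrune [Finite A] (c : UpsetChart M U) (hU : ∀ a, (U a).Nonempty) (ε : ℝ≥0) :
    UpsetChart (subquot (pruneI ε M) (pruneK ε M)) (pruneUpset ε U) where
  coord p := Submodule.liftQ _ ((c.coord p).comp ((pruneI ε M).carrier p).subtype) <| by
    intro x hx
    have hx' : (x : M.obj p) ∈ (pruneK ε M).carrier p := hx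
    rw [c.pruneK_eq_bot, Submodule.mem_bot] at hx'
    rw [LinearMap.mem_ker, LinearMap.comp_apply, Submodule.subtype_apply, hx', map_zero]
  coord_injective p := by
    intro x y h
    obtain ⟨x, rfl⟩ := Submodule.mkQ_surjective _ x
    obtain ⟨y, rfl⟩ := Submodule.mkQ_surjective _ y
    exact congrArg _ (Subtype.ext (c.coord_injective p h))
  coord_map {p q} h x := by
    obtain ⟨y, rfl⟩ := Submodule.mkQ_surjective _ x
    exact c.coord_map h (y : M.obj p)
  exists_coord_eq_iff p v := by
    constructor
    · rintro ⟨x, rfl⟩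
      obtain ⟨y, rfl⟩ := Submodule.mkQ_surjective _ x
      exact (c.mem_pruneI_iff hU ε (y : M.obj p)).1 y.2
    · intro h
      have h' : ∀ a, v a ≠ 0 → p ∈ U a := fun a ha => pruneUpset_subset ε U a (h a ha)
      refine ⟨Submodule.mkQ _ ⟨c.elem v h', (c.mem_pruneI_iff hU ε _).2 fun a ha => h a ?_⟩, ?_⟩
      · rwa [c.coord_elem] at ha
      · exact c.coord_elem v h'

/-- The chart of the `ε`-pruning. -/
def prune [Finite A] (c : UpsetChart M U) (hU : ∀ a, (U a).Nonempty) (ε : ℝ≥0) :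
    UpsetChart (pruning ε M) fun a => RPow.shift (-(ε : ℝ)) ⁻¹' pruneUpset ε U a :=
  (c.subquotPrune hU ε).shift _

end UpsetChart

end PersMod

end

namespace PersMod

/-! ## Injections from linear independence -/

/-- Hall's marriage theorem: finitely many of the vectors are independent in the space spanned by
the union of their supports, so that union is at least as large. -/
theorem exists_injective_of_linearIndependent {k : Type*} [Field k] {J A : Type*}
    {v : J → A →₀ k} (hv : LinearIndependent k v) :
    ∃ σ : J → A, Function.Injective σ ∧ ∀ j, v j (σ j) ≠ 0 := by
  classical
  have hall : ∀ s : Finset J, s.card ≤ (s.biUnion fun j => (v j).support).card := by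
    intro s
    set t := s.biUnion fun j => (v j).support
    let w : s → Finsupp.supported k k (t : Set A) := fun j =>
      ⟨v j, fun a ha => Finset.mem_coe.2 (Finset.mem_biUnion.2 ⟨j, j.2, ha⟩)⟩
    have hw : LinearIndependent k w :=
      LinearIndependent.of_comp (Submodule.subtype _)
        (hv.comp (fun j : s => (j : J)) Subtype.val_injective)
    let e := Finsupp.supportedEquivFinsupp (M := k) (R := k) (t : Set A)
    have : Module.Finite k (Finsupp.supported k k (t : Set A)) := Module.Finite.equiv e.symm
    have h := hw.fintype_card_le_finrank
    rw [e.finrank_eq, Module.finrank_finsupp_self] at h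
    simpa using h
  obtain ⟨σ, hσ, h⟩ := (Finset.all_card_le_biUnion_card_iff_exists_injective _).1 hall
  exact ⟨σ, hσ, fun j => Finsupp.mem_support_iff.1 (h j)⟩

/-! ## The combinatorial matching -/

/-! ### Counting arguments for growing finite sets -/

section Growth

variable {A B : Type*}

theorem card_lt_of_not_closed {s : A → A → Prop} {E E' : Finset A} (h : E ⊆ E')
    (hs : ∀ a b, a ∈ E → s a b → b ∈ E') (hE : ¬∀ a b, a ∈ E → s a b → b ∈ E) :
    E.card < E'.card := by
  push Not at hE
  obtain ⟨a, b, ha, hab, hb⟩ := hE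
  exact Finset.card_lt_card
    (Finset.ssubset_iff_subset_ne.2 ⟨h, fun h' => hb (h' ▸ hs a b ha hab)⟩)

/-- Until `P` holds, `E m` is not closed and gains an element, so it has at least `m + 1` elements.
At `n` it is then everything, and thus closed. -/
theorem mem_of_growth [Fintype A] {s : A → A → Prop} {a : A} {E : ℕ → Finset A} {P : ℕ → Prop}
    (hE : Monotone E) (hs : ∀ m a b, a ∈ E m → s a b → b ∈ E (m + 1)) (h0 : a ∈ E 0)
    (hP : Monotone P) (hEP : ∀ m, (∀ a b, a ∈ E m → s a b → b ∈ E m) → P m)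
    {n : ℕ} (hn : Fintype.card A ≤ n + 1) : P n := by
  have key : ∀ m, P m ∨ m + 1 ≤ (E m).card := by
    intro m
    induction m with
    | zero => exact Or.inr (Finset.card_pos.2 ⟨a, h0⟩)
    | succ m ih =>
      by_cases hc : ∀ a b, a ∈ E m → s a b → b ∈ E m
      · exact Or.inl (hP m.le_succ (hEP m hc))
      · refine ih.imp (hP m.le_succ) fun h => ?_
        exact h.trans_lt (card_lt_of_not_closed (hE m.le_succ) (hs m) hc)
  refine (key n).elim id fun h => hEP n fun _ b _ _ => ?_
  rw [(Finset.card_eq_iff_eq_univ _).1 (le_antisymm (Finset.card_le_univ _) (hn.trans h))]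
  exact Finset.mem_univ b

/-- As long as `a ∉ O m`, one of `E m`, `O m` has at least `m + 1` elements. A large set that is not
closed grows by itself; if closed, it passes its size on, from `E m` to `O m` by `τ` and from `O m`
to `E (m + 1)` by `σ`. -/
theorem mem_of_double_growth [Fintype A] [Fintype B] {s : A → A → Prop} {s' : B → B → Prop} {σ : A → B} {τ : B → A}
    (hσ : Function.Injective σ) (hτ : Function.Injective τ) {a : A}
    {E : ℕ → Finset B} {O : ℕ → Finset A} (hE : Monotone E) (hO : Monotone O)
    (hsE : ∀ m b b', b ∈ E m → s' b b' → b' ∈ E (m + 1))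
    (hsO : ∀ m a a', a ∈ O m → s a a' → a' ∈ O (m + 1)) (h0 : σ a ∈ E 0)
    (hEO : ∀ m, (∀ b b', b ∈ E m → s' b b' → b' ∈ E m) → ∀ b ∈ E m, τ b ∈ O m)
    (hOE : ∀ m, (∀ a a', a ∈ O m → s a a' → a' ∈ O m) → ∀ a ∈ O m, σ a ∈ E (m + 1))
    {n : ℕ} (hn : Fintype.card A ≤ n + 1) : a ∈ O n := by
  classical
  have hEO' : ∀ m, (∀ b b', b ∈ E m → s' b b' → b' ∈ E m) → (E m).card ≤ (O m).card :=
    fun m hc => Finset.card_le_card_of_injOn τ (hEO m hc) hτ.injOn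
  have key : ∀ m, a ∈ O m ∨ m + 1 ≤ (E m).card ∨ m + 1 ≤ (O m).card := by
    intro m
    induction m with
    | zero => exact Or.inr (Or.inl (Finset.card_pos.2 ⟨_, h0⟩))
    | succ m ih =>
      by_cases ha : a ∈ O m
      · exact Or.inl (hO m.le_succ ha)
      have hOm : m + 1 ≤ (O m).card →
          m + 1 + 1 ≤ (E (m + 1)).card ∨ m + 1 + 1 ≤ (O (m + 1)).card := by
        intro h
        by_cases hc : ∀ a a', a ∈ O m → s a a' → a' ∈ O m
        -- The extra element: `σ a` has been in `E` from the start, but is not in the image of `O m`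
        -- because `a ∉ O m`.
        · have h2 : insert (σ a) ((O m).image σ) ⊆ E (m + 1) :=
            Finset.insert_subset (hE (Nat.zero_le _) h0) (Finset.image_subset_iff.2 (hOE m hc))
          have h3 := Finset.card_le_card h2
          rw [Finset.card_insert_of_notMem (by simpa [hσ.eq_iff] using ha),
            Finset.card_image_of_injective _ hσ] at h3
          exact Or.inl (by omega)
        · exact Or.inr (h.trans_lt (card_lt_of_not_closed (hO m.le_succ) (hsO m) hc))
      refine Or.inr (ih.elim (fun h => absurd h ha) fun h => h.elim (fun h => ?_) hOm)
      by_cases hc : ∀ b b', b ∈ E m → s' b b' → b' ∈ E m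
      · exact hOm (h.trans (hEO' m hc))
      · exact Or.inl (h.trans_lt (card_lt_of_not_closed (hE m.le_succ) (hsE m) hc))
  have hcard : Fintype.card A = Fintype.card B :=
    le_antisymm (Fintype.card_le_of_injective σ hσ) (Fintype.card_le_of_injective τ hτ)
  have huniv : Fintype.card A ≤ (O n).card → a ∈ O n := fun h => by
    rw [(Finset.card_eq_iff_eq_univ _).1 (le_antisymm (Finset.card_le_univ _) h)]
    exact Finset.mem_univ a
  rcases key n with h | h | h
  · exact h
  · have hE' : E n = Finset.univ := (Finset.card_eq_iff_eq_univ _).1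
      (le_antisymm (Finset.card_le_univ _) (by omega))
    exact huniv ((hn.trans h).trans (hEO' n fun _ b' _ _ => hE' ▸ Finset.mem_univ b'))
  · exact huniv (hn.trans h)

end Growth

/-! ### Inclusions of upsets up to a shift -/

section Matching

variable {d : ℕ} {A B : Type*} {U : A → Set (RPow d)} {V : B → Set (RPow d)}

theorem subset_shift_of_le {X Y : Set (RPow d)} (hY : IsUpperSet Y) {s t : ℝ} (h : s ≤ t)
    (hX : X ⊆ RPow.shift s ⁻¹' Y) : X ⊆ RPow.shift t ⁻¹' Y :=
  fun p hp => hY (RPow.shift_le_shift h p) (hX hp)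

theorem subset_shift_trans {X Y Z : Set (RPow d)} {s t u : ℝ} (hu : s + t = u)
    (hX : X ⊆ RPow.shift s ⁻¹' Y) (hY : Y ⊆ RPow.shift t ⁻¹' Z) : X ⊆ RPow.shift u ⁻¹' Z := by
  intro p hp
  have := hY (hX hp)
  rwa [Set.mem_preimage, RPow.shift_shift, hu] at this

/-- Everything reachable from a member of a closed `E` stays in `E`, so `X` lies, up to `s`, in the
pruned upsets of the members. Passing through `hσ` costs one more `ε`. -/
theorem subset_shift_of_closed {X : Set (RPow d)} {ε : ℝ≥0} {σ : A → B}
    (hσ : ∀ a, RPow.shift (-(ε : ℝ)) ⁻¹' pruneUpset ε U a ⊆ V (σ a)) {E : Set A}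
    (hE : ∀ a b, a ∈ E → PruneStep ε U a b → b ∈ E) {s t : ℝ} (hst : s + ε = t)
    (hX : ∀ a ∈ E, X ⊆ RPow.shift s ⁻¹' U a) : ∀ a ∈ E, X ⊆ RPow.shift t ⁻¹' V (σ a) := by
  intro a ha p hp
  refine hσ a fun b hab => ?_
  have hb : b ∈ E := by
    induction hab with
    | refl => exact ha
    | tail _ h ih => exact hE _ _ ih h
  have hs : RPow.shift (-(ε : ℝ)) (RPow.shift t p) = RPow.shift s p := by
    rw [RPow.shift_shift]
    congr 1
    linarith
  rw [hs]
  exact hX b hb hp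

theorem subset_shift_matching [Fintype A] (hU : ∀ a, IsUpperSet (U a))
    (hV : ∀ b, IsUpperSet (V b)) {ε : ℝ≥0} {σ : A → B}
    (hσ : ∀ a, RPow.shift (-(ε : ℝ)) ⁻¹' pruneUpset ε U a ⊆ V (σ a))
    {n : ℕ} (hn : Fintype.card A ≤ n + 1) (a : A) :
    U a ⊆ RPow.shift ((2 * n + 1) * ε) ⁻¹' V (σ a) := by
  classical
  have hε := ε.coe_nonneg
  refine mem_of_growth (s := PruneStep ε U) (a := a)
    (E := fun m => Finset.univ.filter fun b => U a ⊆ RPow.shift (2 * m * ε) ⁻¹' U b)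
    (P := fun m => U a ⊆ RPow.shift ((2 * m + 1) * ε) ⁻¹' V (σ a)) ?_ ?_ ?_ ?_ ?_ hn
  · intro m m' hm b hb
    rw [Finset.mem_filter_univ] at hb ⊢
    refine subset_shift_of_le (hU b) ?_ hb
    gcongr
  · intro m b b' hb h
    rw [Finset.mem_filter_univ] at hb ⊢
    exact subset_shift_trans (by push_cast; ring) hb h
  · rw [Finset.mem_filter_univ]
    intro p hp
    simpa [RPow.shift_zero] using hp
  · intro m m' hm hb
    refine subset_shift_of_le (hV _) ?_ hb
    gcongr
  · intro m hc
    refine subset_shift_of_closed hσ (E := {b | U a ⊆ RPow.shift (2 * m * ε) ⁻¹' U b})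
      (fun b b' hb h => ?_) (by ring) (fun b hb => hb) a ?_
    · have := hc b b' ((Finset.mem_filter_univ _).2 hb) h
      rwa [Finset.mem_filter_univ] at this
    · refine subset_shift_of_le (hU a) (s := 0) (by positivity) fun p hp => ?_
      rwa [Set.mem_preimage, RPow.shift_zero]

theorem subset_shift_matching' [Fintype A] [Fintype B] (hU : ∀ a, IsUpperSet (U a))
    (hV : ∀ b, IsUpperSet (V b)) {ε : ℝ≥0} {σ : A → B} {τ : B → A} (hσi : Function.Injective σ) (hτi : Function.Injective τ)
    (hσ : ∀ a, RPow.shift (-(ε : ℝ)) ⁻¹' pruneUpset ε U a ⊆ V (σ a))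
    (hτ : ∀ b, RPow.shift (-(ε : ℝ)) ⁻¹' pruneUpset ε V b ⊆ U (τ b))
    {n : ℕ} (hn : Fintype.card A ≤ n + 1) (a : A) :
    V (σ a) ⊆ RPow.shift ((2 * n + 1) * ε) ⁻¹' U a := by
  classical
  have hε := ε.coe_nonneg
  refine (Finset.mem_filter_univ (p := fun a' =>
    V (σ a) ⊆ RPow.shift ((2 * n + 1) * ε) ⁻¹' U a') a).1 (mem_of_double_growth (s := PruneStep ε U) (s' := PruneStep ε V) hσi hτi
    (E := fun m => Finset.univ.filter fun b => V (σ a) ⊆ RPow.shift (2 * m * ε) ⁻¹' V b)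
    (O := fun m => Finset.univ.filter fun a' => V (σ a) ⊆ RPow.shift ((2 * m + 1) * ε) ⁻¹' U a')
    ?_ ?_ ?_ ?_ ?_ ?_ ?_ hn)
  · intro m m' hm b hb
    rw [Finset.mem_filter_univ] at hb ⊢
    refine subset_shift_of_le (hV b) ?_ hb
    gcongr
  · intro m m' hm b hb
    rw [Finset.mem_filter_univ] at hb ⊢
    refine subset_shift_of_le (hU b) ?_ hb
    gcongr
  · intro m b b' hb h
    rw [Finset.mem_filter_univ] at hb ⊢
    exact subset_shift_trans (by push_cast; ring) hb h
  · intro m b b' hb h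
    rw [Finset.mem_filter_univ] at hb ⊢
    exact subset_shift_trans (by push_cast; ring) hb h
  · rw [Finset.mem_filter_univ]
    intro p hp
    simpa [RPow.shift_zero] using hp
  · intro m hc b hb
    rw [Finset.mem_filter_univ] at hb ⊢
    refine subset_shift_of_closed hτ (E := {b | V (σ a) ⊆ RPow.shift (2 * m * ε) ⁻¹' V b})
      (fun b b' hb h => ?_) (by ring) (fun b hb => hb) b hb
    have := hc b b' ((Finset.mem_filter_univ _).2 hb) h
    rwa [Finset.mem_filter_univ] at this
  · intro m hc b hb
    rw [Finset.mem_filter_univ] at hb ⊢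
    refine subset_shift_of_closed hσ
      (E := {b | V (σ a) ⊆ RPow.shift ((2 * m + 1) * ε) ⁻¹' U b})
      (fun b b' hb h => ?_) (by push_cast; ring) (fun b hb => hb) b hb
    have := hc b b' ((Finset.mem_filter_univ _).2 hb) h
    rwa [Finset.mem_filter_univ] at this

end Matching

end PersMod

noncomputable section

namespace PersMod

variable {k : Type u} [Field k] {d : ℕ} {M N : PersMod k d}

/-! ## Direct sums -/

open Classical in
/-- The inclusion of a summand. -/
def directSumι {I : Type u} (P : I → PersMod k d) (i : I) : P i ⟶ directSum P where
  app p := ModuleCat.ofHom (DirectSum.lof k I (fun i => (P i).obj p) i)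
  naturality p q f := by
    ext x
    exact (DirectSum.lmap_lof (fun i => ((P i).map f).hom) i x).symm

/-- The projection to a summand. -/
def directSumπ {I : Type u} (P : I → PersMod k d) (i : I) : directSum P ⟶ P i where
  app p := ModuleCat.ofHom (DirectSum.component k I (fun i => (P i).obj p) i)
  naturality _ _ _ := rfl

theorem directSumι_π {I : Type u} (P : I → PersMod k d) (i : I) :
    directSumι P i ≫ directSumπ P i = 𝟙 (P i) := by
  classical
  ext p x
  exact DirectSum.component.lof_self k (M := fun i => (P i).obj p) i x

theorem linearIndependent_lof {I : Type*} [DecidableEq I] {E : I → Type*}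
    [∀ i, AddCommGroup (E i)] [∀ i, Module k (E i)] {x : ∀ i, E i} (hx : ∀ i, x i ≠ 0) :
    LinearIndependent k fun i => DirectSum.lof k I E i (x i) := by
  rw [linearIndependent_iff']
  intro s g hg i hi
  have h := congrArg (DirectSum.component k I E i) hg
  rw [map_sum, map_zero, Finset.sum_eq_single i] at h
  · rw [map_smul, DirectSum.component.lof_self] at h
    exact (smul_eq_zero.1 h).resolve_right (hx i)
  · intro j _ hj
    rw [map_smul, DirectSum.component.of, dif_neg hj, smul_zero]
  · exact fun h => absurd hi h

theorem mem_of_upsetFibre_ne_zero {U : Set (RPow d)} {p : RPow d} {x : upsetFibre k U p}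
    (h : (x : k) ≠ 0) : p ∈ U := by
  by_contra hp
  obtain ⟨t, ht⟩ := x
  rw [upsetFibre, if_neg hp, Submodule.mem_bot] at ht
  exact h ht

theorem mem_upsetFibre {U : Set (RPow d)} {p : RPow d} {t : k} (h : t ≠ 0 → p ∈ U) :
    t ∈ upsetFibre k U p := by
  by_cases ht : t = 0
  · rw [ht]
    exact zero_mem _
  · rw [upsetFibre, if_pos (h ht)]
    exact Submodule.mem_top

namespace UpsetChart

/-- The chart of an upset module. -/
def upsetModule (U : Set (RPow d)) (hU : IsUpperSet U) :
    UpsetChart (PersMod.upsetModule k U hU) fun _ : Unit => U where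
  coord p := LinearMap.pi fun _ => (upsetFibre k U p).subtype
  coord_injective p x y h := Subtype.ext (congrFun h ())
  coord_map _ _ := rfl
  exists_coord_eq_iff p v := by
    constructor
    · rintro ⟨x, rfl⟩ _ h
      exact mem_of_upsetFibre_ne_zero h
    · exact fun h => ⟨⟨v (), mem_upsetFibre (h ())⟩, rfl⟩

/-- The chart of a direct sum of upset modules all of which, apart from finitely many, are zero. -/
def directSum {I : Type u} {A : Type*} [Finite A] (U : I → Set (RPow d))
    (hU : ∀ i, IsUpperSet (U i)) (e : A → I) (he : Function.Injective e)
    (hne : ∀ i, (U i).Nonempty → i ∈ Set.range e) :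
    UpsetChart (PersMod.directSum fun i => PersMod.upsetModule k (U i) (hU i))
      (fun a => U (e a)) where
  coord p := LinearMap.pi fun a => (upsetFibre k (U (e a)) p).subtype.comp
    (DirectSum.component k I (fun i => upsetFibre k (U i) p) (e a))
  coord_injective p x y h := by
    refine DirectSum.ext_component k (M := fun i => upsetFibre k (U i) p) fun i => ?_
    by_cases hi : i ∈ Set.range e
    · obtain ⟨a, rfl⟩ := hi
      exact Subtype.ext (congrFun h a)
    · have h0 : ∀ z : upsetFibre k (U i) p, z = 0 := fun z => Subtype.ext <| by
        by_contra hz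
        exact hi (hne i ⟨p, mem_of_upsetFibre_ne_zero hz⟩)
      exact (h0 _).trans (h0 _).symm
  coord_map _ _ := rfl
  exists_coord_eq_iff p v := by
    classical
    have := Fintype.ofFinite A
    constructor
    · rintro ⟨x, rfl⟩ a h
      exact mem_of_upsetFibre_ne_zero h
    · intro h
      let x : ⨁ i, upsetFibre k (U i) p := ∑ a, DirectSum.lof k I (fun i => upsetFibre k (U i) p)
        (e a) ⟨v a, mem_upsetFibre (h a)⟩
      have hx : ∀ a, DirectSum.component k I (fun i => upsetFibre k (U i) p) (e a) x =
          ⟨v a, mem_upsetFibre (h a)⟩ := by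
        intro a
        rw [map_sum, Finset.sum_eq_single a]
        · rw [DirectSum.component.lof_self]
        · intro b _ hb
          rw [DirectSum.component.of, dif_neg fun h => hb (he h)]
        · exact fun h => absurd (Finset.mem_univ a) h
      exact ⟨x, funext fun a => congrArg Subtype.val (hx a)⟩

end UpsetChart

theorem exists_upsetChart (hM : M.IsUpsetDecomposable) {r : ℕ} (hr : M.supdim ≤ r) :
    ∃ (A : Type u) (_ : Fintype A) (U : A → Set (RPow d)), Fintype.card A ≤ r ∧
      (∀ a, (U a).Nonempty) ∧ Nonempty (UpsetChart M U) := by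
  classical
  obtain ⟨I, U, hU, ⟨e⟩⟩ := hM
  -- At a point common to the upsets indexed by `s`, their generators are independent, so the
  -- dimension there is at least `s.card`.
  have hcard : ∀ s : Finset I, (s : Set I) ⊆ {i | (U i).Nonempty} → s.card ≤ r := by
    intro s hs
    obtain ⟨p, hp⟩ := RPow.exists_forall_mem (U := fun i : s => U i) (fun i => hU i)
      fun i => hs i.2
    let x : ∀ i : I, upsetFibre k (U i) p := fun i =>
      if hi : i ∈ s then ⟨1, mem_upsetFibre fun _ => hp ⟨i, hi⟩⟩ else 0
    have hx : LinearIndependent k fun i : s =>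
        DirectSum.lof k I (fun i => upsetFibre k (U i) p) i (x i) := by
      rw [linearIndependent_iff']
      intro t g hg i hi
      have h := congrArg (DirectSum.component k I (fun i => upsetFibre k (U i) p) i) hg
      rw [map_sum, map_zero, Finset.sum_eq_single i] at h
      · rw [map_smul, DirectSum.component.lof_self] at h
        refine (smul_eq_zero.1 h).resolve_right fun h0 => ?_
        have h1 := congrArg Subtype.val h0
        simp [x] at h1
      · intro j _ hj
        rw [map_smul, DirectSum.component.of, dif_neg fun h => hj (Subtype.ext h), smul_zero]
      · exact fun h => absurd hi h
    have h1 := hx.cardinal_le_rank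
    have h2 : Cardinal.mk s ≤ Module.rank k (M.obj p) := by
      have e' : M.obj p ≃ₗ[k] (⨁ i, upsetFibre k (U i) p) := (e.app p).toLinearEquiv
      rw [e'.rank_eq]
      exact h1
    have h3 : Cardinal.toENat (Module.rank k (M.obj p)) ≤ r :=
      (le_iSup (fun p => Cardinal.toENat (Module.rank k (M.obj p))) p).trans hr
    have h4 := (Cardinal.toENat.monotone' h2).trans h3
    simpa using h4
  have hA := Cardinal.mk_le_iff_forall_finset_subset_card_le.2 hcard
  have hfin : Finite {i // (U i).Nonempty} :=
    Cardinal.lt_aleph0_iff_finite.1 (hA.trans_lt (Cardinal.natCast_lt_aleph0))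
  have := Fintype.ofFinite {i // (U i).Nonempty}
  refine ⟨{i // (U i).Nonempty}, this, fun a => U a, ?_, fun a => a.2, ⟨?_⟩⟩
  · have h : Cardinal.mk {i // (U i).Nonempty} ≤ r := hA
    rw [Cardinal.mk_fintype] at h
    exact_mod_cast h
  · exact (UpsetChart.directSum U hU Subtype.val Subtype.val_injective
      fun i hi => ⟨⟨i, hi⟩, rfl⟩).ofIso e

/-! ## Indecomposable summands -/

theorem isZero_of_id_eq_zero {C : Type*} [Category* C] [HasZeroMorphisms C] {X : C}
    (h : 𝟙 X = 0) : IsZero X := (IsZero.iff_id_eq_zero X).2 h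

theorem UpsetChart.indecomposable {U : Set (RPow d)} (c : UpsetChart M fun _ : Unit => U)
    (hne : U.Nonempty) : Indecomposable M := by
  obtain ⟨p, hp⟩ := hne
  constructor
  · intro h
    obtain ⟨x, hx⟩ := c.exists_coord_single (a := ()) hp 1
    have h0 : (𝟙 M : M ⟶ M).app p x = (0 : M ⟶ M).app p x := by rw [h.eq_of_src (𝟙 M) 0]
    have hx0 : x = 0 := h0
    rw [hx0, map_zero] at hx
    simpa using congrFun hx ()
  · intro Y Z e
    -- The projection onto `Y`. In the single coordinate it is an idempotent scalar, so it is zero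
    -- or the identity.
    let f : M ⟶ M := e.hom ≫ biprod.fst ≫ biprod.inl ≫ e.inv
    have hff : f ≫ f = f := by simp [f]
    obtain ⟨T, hT⟩ := c.exists_linear c (fun _ => ⟨p, hp⟩) f
    have hTv : ∀ v : Unit → k, T v = v () • T 1 := fun v => by
      rw [← map_smul]
      congr 1
      ext
      simp
    have hTT : T (T 1) = T 1 := by
      obtain ⟨x, hx⟩ := c.surjective (p := p) (fun _ => hp) 1
      have := hT p (f.app p x)
      rwa [← ConcreteCategory.comp_apply, ← NatTrans.comp_app, hff, hT, hx, eq_comm] at this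
    have h01 : T 1 () = 0 ∨ T 1 () = 1 := by
      rw [hTv (T 1)] at hTT
      have h := congrFun hTT ()
      rw [Pi.smul_apply, smul_eq_mul] at h
      by_cases h0 : T 1 () = 0
      · exact Or.inl h0
      · exact Or.inr (mul_right_cancel₀ h0 (h.trans (one_mul _).symm))
    rcases h01 with h | h
    · left
      have hf : f = 0 := c.hom_ext fun q x => by
        rw [hT, hTv]
        ext
        simp [h]
      refine isZero_of_id_eq_zero ?_
      have : biprod.inl ≫ e.inv ≫ f ≫ e.hom ≫ biprod.fst = 𝟙 Y := by simp [f]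
      rw [← this, hf]
      simp
    · right
      have hf : f = 𝟙 M := c.hom_ext fun q x => by
        rw [hT, hTv]
        ext
        simp [h]
      refine isZero_of_id_eq_zero ?_
      have : biprod.inr ≫ e.inv ≫ f ≫ e.hom ≫ biprod.snd = 0 := by simp [f]
      rw [← this, hf]
      simp

/-- A retract is a direct summand, whose complement, the cokernel, must vanish. -/
theorem nonempty_iso_of_indecomposable {C : Type*} [Category* C] [Abelian C] {X P : C}
    (hP : Indecomposable P) (hX : ¬IsZero X) {g : X ⟶ P} {h : P ⟶ X} (hgh : g ≫ h = 𝟙 X) :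
    Nonempty (P ≅ X) := by
  have : IsSplitMono g := IsSplitMono.mk' ⟨h, hgh⟩
  have hc := cokernelIsCokernel g
  have e := biprod.uniqueUpToIso _ _ (isBilimitBinaryBiconeOfIsSplitMonoOfCokernel hc)
  have hz := (hP.2 _ _ e).resolve_left hX
  have : Epi g := Preadditive.epi_of_isZero_cokernel g hz
  have : IsIso g := isIso_of_mono_of_epi g
  exact ⟨(asIso g).symm⟩

/-- An indecomposable direct summand of a finite direct sum of upset modules is one of them. -/
theorem UpsetChart.exists_upsetChart_of_retract {A : Type*} [Finite A] {U : A → Set (RPow d)}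
    (c : UpsetChart M U) (hne : ∀ a, (U a).Nonempty) {P : PersMod k d} (hP : Indecomposable P)
    {s : P ⟶ M} {r : M ⟶ P} (hsr : s ≫ r = 𝟙 P) :
    ∃ a, Nonempty (UpsetChart P fun _ : Unit => U a) := by
  classical
  obtain ⟨T, hT⟩ := c.exists_linear c hne (r ≫ s)
  obtain ⟨o, ho⟩ := RPow.exists_forall_mem c.isUpperSet hne
  have hTT : ∀ v, T (T v) = T v := by
    intro v
    obtain ⟨x, rfl⟩ := c.surjective ho v
    rw [← hT, ← hT, ← ConcreteCategory.comp_apply, ← NatTrans.comp_app, Category.assoc,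
      reassoc_of% hsr]
  have hsub : ∀ a b, T (Pi.single a 1) b ≠ 0 → U a ⊆ U b :=
    fun a b h => c.subset_of_linear c hT h
  have hT0 : ∃ a, T (Pi.single a 1) ≠ 0 := by
    by_contra! h
    refine hP.1 (isZero_of_id_eq_zero ?_)
    have hrs : r ≫ s = 0 := c.hom_ext fun p x => by
      rw [hT]
      refine Eq.trans (funext fun b => ?_) (map_zero (c.coord p)).symm
      by_contra hb
      obtain ⟨a, -, ha⟩ := exists_ne_zero_of_linear T hb
      exact ha (congrFun (h a) b)
    have : s ≫ (r ≫ s) ≫ r = 𝟙 P := by rw [Category.assoc, hsr, Category.comp_id, hsr]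
    rw [← this, hrs]
    simp
  -- Since `T` is idempotent, `T e_a = T (T e_a) ≠ 0` gives an `i` with nonzero entry from `a` to
  -- `i` and `T e_i ≠ 0`. Then `U a ⊆ U i`, and maximality of `U a` forces equality.
  obtain ⟨a, ha, hmax⟩ := (Set.toFinite {a | T (Pi.single a 1) ≠ 0}).exists_maximalFor U _ hT0
  obtain ⟨b, hb⟩ := Function.ne_iff.1 ha
  rw [← hTT] at hb
  obtain ⟨i, hai, hib⟩ := exists_ne_zero_of_linear T hb
  have hia : U i = U a := (hmax (fun h0 => hib (by simp [h0])) (hsub a i hai)).antisymm (hsub a i hai)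
  let c₀ := UpsetChart.upsetModule (k := k) (U a) (c.isUpperSet a)
  let g := c₀.elementary c (a := ()) (b := a) subset_rfl
  let h := c.elementary c₀ (a := i) (b := ()) hia.le
  let t := T (Pi.single a 1) i
  -- Going from `U a` through `P` to `U i = U a` is multiplication by the entry `t ≠ 0`, so the
  -- upset module of `U a` is a retract of `P`.
  have hgh : (g ≫ r) ≫ (t⁻¹ • (s ≫ h)) = 𝟙 _ := c₀.hom_ext fun p x => by
    have h1 : c₀.coord p ((g ≫ (r ≫ s) ≫ h).app p x) = t • c₀.coord p x := by
      change c₀.coord p (h.app p ((r ≫ s).app p (g.app p x))) = _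
      rw [coord_elementary, hT, coord_elementary]
      have : (Pi.single a (c₀.coord p x ()) : A → k) = c₀.coord p x () • Pi.single a 1 := by
        rw [← Pi.single_smul, smul_eq_mul, mul_one]
      rw [this, map_smul]
      ext
      simp [t, mul_comm]
    have h2 : (g ≫ r) ≫ (t⁻¹ • (s ≫ h)) = t⁻¹ • (g ≫ (r ≫ s) ≫ h) := by
      simp
    rw [h2]
    change c₀.coord p (t⁻¹ • ((g ≫ (r ≫ s) ≫ h).app p x)) = c₀.coord p x
    rw [map_smul, h1, inv_smul_smul₀ hai]
  obtain ⟨e⟩ := nonempty_iso_of_indecomposable hP (c₀.indecomposable (hne a)).1 hgh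
  exact ⟨a, ⟨c₀.ofIso e⟩⟩

end PersMod

end

noncomputable section

namespace PersMod

variable {k : Type u} [Field k] {d : ℕ} {M N : PersMod k d}

/-! ## Refinements of direct sums of upset modules -/

theorem IsSubquotient.exists_injective (h : IsSubquotient N M) (p : RPow d) :
    ∃ f : N.obj p →ₗ[k] M.obj p, Function.Injective f := by
  obtain ⟨I, K, -, ⟨e⟩⟩ := h
  have e' : N.obj p ≃ₗ[k] (I.carrier p ⧸ (K.carrier p).submoduleOf (I.carrier p)) :=
    (e.app p).toLinearEquiv
  rw [← rank_le_iff_exists_linearMap, e'.rank_eq]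
  exact (rank_quotient_le _).trans (Submodule.rank_le _)

theorem hom_app_injective (e : M ≅ N) (p : RPow d) : Function.Injective (e.hom.app p).hom :=
  (ModuleCat.mono_iff_injective _).1 inferInstance

theorem app_injective_of_comp_eq_id {f : M ⟶ N} {g : N ⟶ M} (h : f ≫ g = 𝟙 M) (p : RPow d) :
    Function.Injective (f.app p).hom :=
  have : IsSplitMono f := IsSplitMono.mk' ⟨g, h⟩
  (ModuleCat.mono_iff_injective _).1 inferInstance

namespace UpsetChart

variable {A J : Type*} [Finite A] {U : A → Set (RPow d)} {W : J → Set (RPow d)}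

/-- A weak substitute for uniqueness of barcodes: generators of the summands have independent images
over a common point, and Hall's theorem picks a nonzero coordinate of each. -/
theorem exists_injective_of_directSum (c : UpsetChart M U) (hne : ∀ a, (U a).Nonempty)
    {I : Type u} {P : I → PersMod k d} {a : I → A}
    (cP : ∀ i, UpsetChart (P i) fun _ : Unit => U (a i)) (e : PersMod.directSum P ≅ M) :
    ∃ ρ : I → A, Function.Injective ρ ∧ ∀ i, U (a i) ⊆ U (ρ i) := by
  classical
  obtain ⟨o, ho⟩ := RPow.exists_forall_mem c.isUpperSet hne
  choose T hT using fun i => (cP i).exists_linear c (fun _ => hne (a i)) (directSumι P i ≫ e.hom)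
  choose x hx using fun i => (cP i).exists_coord_single (a := ()) (ho (a i)) 1
  have hx0 : ∀ i, x i ≠ 0 := fun i h0 => by
    have := hx i
    rw [h0, map_zero] at this
    simpa using congrFun this ()
  let F : (⨁ i, (P i).obj o) →ₗ[k] (A → k) := (c.coord o).comp (e.hom.app o).hom
  have hF : Function.Injective F := (c.coord_injective o).comp (hom_app_injective e o)
  have hli : LinearIndependent k fun i => T i (Pi.single () 1) := by
    have hw : (fun i => T i (Pi.single () 1)) =
        F ∘ fun i => DirectSum.lof k I (fun i => (P i).obj o) i (x i) := funext fun i => by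
      rw [← hx i, ← hT i]
      rfl
    rw [hw]
    exact (linearIndependent_lof hx0).map' F (LinearMap.ker_eq_bot.2 hF)
  obtain ⟨ρ, hρ, h⟩ := exists_injective_of_linearIndependent
    (hli.map' (Finsupp.linearEquivFunOnFinite k k A).symm.toLinearMap (LinearEquiv.ker _))
  exact ⟨ρ, hρ, fun i => (cP i).subset_of_linear c (hT i) (a := ()) (h i)⟩

theorem exists_injective_of_summands [Finite J] (c : UpsetChart M W)
    (hne : ∀ j, (W j).Nonempty) {I : Type u} {Q : I → PersMod k d} (e : M ≅ PersMod.directSum Q)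
    (hQ : ∀ i p, ∃ f : (Q i).obj p →ₗ[k] k, Function.Injective f) :
    ∃ τ : J → I, Function.Injective τ ∧
      ∀ j, ∀ p ∈ W j, ∃ y : (Q (τ j)).obj p, y ≠ 0 := by
  classical
  obtain ⟨o, ho⟩ := RPow.exists_forall_mem c.isUpperSet hne
  choose x hx using fun j => c.exists_coord_single (ho j) 1
  choose f hf using fun i => hQ i o
  have hli : LinearIndependent k x := by
    refine LinearIndependent.of_comp (c.coord o) ?_
    have hw : c.coord o ∘ x = Pi.basisFun k J := funext fun j => by
      rw [Pi.basisFun_apply]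
      exact hx j
    rw [hw]
    exact (Pi.basisFun k J).linearIndependent
  let F : M.obj o →ₗ[k] (I →₀ k) := (finsuppLequivDFinsupp k).symm.toLinearMap.comp
    ((DirectSum.lmap f).comp (e.hom.app o).hom)
  have hF : Function.Injective F := (finsuppLequivDFinsupp k).symm.injective.comp
    (((DirectSum.lmap_injective f).2 hf).comp (hom_app_injective e o))
  obtain ⟨τ, hτ, h⟩ := exists_injective_of_linearIndependent
    (hli.map' F (LinearMap.ker_eq_bot.2 hF))
  refine ⟨τ, hτ, fun j p hp => ?_⟩
  let π := e.hom ≫ directSumπ Q (τ j)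
  let ι := directSumι Q (τ j) ≫ e.inv
  have hιπ : ι ≫ π = 𝟙 _ := by simp [ι, π, directSumι_π]
  have hπ : π.app o (x j) ≠ 0 := by
    intro h0
    refine h j ?_
    have h1 : F (x j) (τ j) = f (τ j) (π.app o (x j)) := rfl
    exact h1.trans (by rw [h0, map_zero])
  -- `Q (τ j)` carries no chart, so its component is tested back in `M`: there `π ≫ ι` acts on the
  -- `j`-th generator by the same vector over `p` and over `o`.
  obtain ⟨T, hT⟩ := c.exists_linear c hne (π ≫ ι)
  obtain ⟨y, hy⟩ := c.exists_coord_single hp 1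
  refine ⟨π.app p y, fun h0 => hπ ?_⟩
  refine app_injective_of_comp_eq_id hιπ o (c.coord_injective o ?_)
  have h1 := hT o (x j)
  have h2 := hT p y
  rw [hy] at h2
  rw [hx] at h1
  refine (h1.trans h2.symm).trans ?_
  change c.coord p (ι.app p (π.app p y)) = _
  rw [h0]
  simp

end UpsetChart

theorem exists_injective_of_isInfRefinement {A J : Type*} [Finite A] [Finite J]
    {W : J → Set (RPow d)} {V : A → Set (RPow d)} (cM : UpsetChart M W) (cN : UpsetChart N V)
    (hW : ∀ j, (W j).Nonempty) (hV : ∀ a, (V a).Nonempty) (h : IsInfRefinement M N) :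
    ∃ σ : J → A, Function.Injective σ ∧ ∀ j, W j ⊆ V (σ j) := by
  obtain ⟨I, P, Q, ⟨hP, ⟨e⟩⟩, hQ, ⟨e'⟩⟩ := h
  have hc : ∀ i, ∃ a, Nonempty (UpsetChart (P i) fun _ : Unit => V a) := fun i =>
    cN.exists_upsetChart_of_retract hV (hP i) (s := directSumι P i ≫ e.inv)
      (r := e.hom ≫ directSumπ P i) (by simp [directSumι_π])
  choose a ha using hc
  let cP := fun i => (ha i).some
  obtain ⟨ρ, hρ, hVρ⟩ := cN.exists_injective_of_directSum hV cP e.symm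
  obtain ⟨τ, hτ, hWτ⟩ := cM.exists_injective_of_summands hW e' fun i p => by
    obtain ⟨f, hf⟩ := (hQ i).exists_injective p
    refine ⟨(LinearMap.proj ()).comp (((cP i).coord p).comp f), fun x y hxy => hf ?_⟩
    exact (cP i).coord_injective p (funext fun _ => hxy)
  refine ⟨ρ ∘ τ, hρ.comp hτ, fun j p hp => hVρ _ ?_⟩
  obtain ⟨y, hy⟩ := hWτ j p hp
  obtain ⟨f, hf⟩ := (hQ (τ j)).exists_injective p
  have h1 : (cP (τ j)).coord p (f y) ≠ 0 := fun h0 =>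
    hy (hf ((cP (τ j)).coord_injective p (by rw [h0, map_zero, map_zero])))
  obtain ⟨i, hi⟩ := Function.ne_iff.1 h1
  exact (cP (τ j)).mem_of_coord_ne_zero hi

theorem preimage_shift_nonempty (t : ℝ) {X : Set (RPow d)} (hX : X.Nonempty) :
    (RPow.shift t ⁻¹' X).Nonempty := by
  obtain ⟨p, hp⟩ := hX
  refine ⟨RPow.shift (-t) p, ?_⟩
  rwa [Set.mem_preimage, RPow.shift_shift, neg_add_cancel, RPow.shift_zero]

theorem exists_injective_of_pruning_isInfRefinement {A B : Type*} [Finite A] [Finite B]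
    {U : A → Set (RPow d)} {V : B → Set (RPow d)} (cM : UpsetChart M U) (cN : UpsetChart N V)
    (hU : ∀ a, (U a).Nonempty) (hV : ∀ b, (V b).Nonempty) {ε : ℝ≥0}
    (h : IsInfRefinement (pruning (ε + 0) M) (pruning 0 N)) :
    ∃ σ : A → B, Function.Injective σ ∧
      ∀ a, RPow.shift (-(ε : ℝ)) ⁻¹' pruneUpset ε U a ⊆ V (σ a) := by
  rw [add_zero] at h
  obtain ⟨σ, hσ, hs⟩ := exists_injective_of_isInfRefinement (cM.prune hU ε) (cN.prune hV 0)
    (fun a => preimage_shift_nonempty _ (pruneUpset_nonempty ε cM.isUpperSet hU a))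
    (fun b => preimage_shift_nonempty _ (pruneUpset_nonempty 0 cN.isUpperSet hV b)) h
  refine ⟨σ, hσ, fun a p hp => ?_⟩
  -- For the target only the inclusion of the `0`-pruned upset in the original one is needed.
  have := pruneUpset_subset _ _ _ (hs a hp)
  rwa [NNReal.coe_zero, neg_zero, RPow.shift_zero] at this

/-! ## Matchings -/

/-- The morphism of upset modules given by an inclusion into a shift. -/
def upsetModuleHom {U V : Set (RPow d)} (hU : IsUpperSet U) (hV : IsUpperSet V) {ε : ℝ≥0}
    (h : U ⊆ RPow.shift (ε : ℝ) ⁻¹' V) :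
    upsetModule k U hU ⟶ (upsetModule k V hV).shift (ε : ℝ) where
  app p := ModuleCat.ofHom (Submodule.inclusion
    (show upsetFibre k U p ≤ upsetFibre k V (RPow.shift ε p) from fun t ht =>
      mem_upsetFibre fun h0 => h (mem_of_upsetFibre_ne_zero (x := ⟨t, ht⟩) h0)))
  naturality _ _ _ := rfl

theorem interleaved_upsetModule {U V : Set (RPow d)} (hU : IsUpperSet U) (hV : IsUpperSet V)
    {ε : ℝ≥0} (h : U ⊆ RPow.shift (ε : ℝ) ⁻¹' V) (h' : V ⊆ RPow.shift (ε : ℝ) ⁻¹' U) :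
    Interleaved ε (upsetModule k U hU) (upsetModule k V hV) :=
  ⟨upsetModuleHom hU hV h, upsetModuleHom hV hU h', fun _ => rfl, fun _ => rfl⟩

theorem UpsetChart.isBarcode {A : Type u} [Finite A] {U : A → Set (RPow d)} (c : UpsetChart M U)
    (hne : ∀ a, (U a).Nonempty) :
    IsBarcode (fun a => PersMod.upsetModule k (U a) (c.isUpperSet a)) M :=
  ⟨fun a => (UpsetChart.upsetModule (U a) (c.isUpperSet a)).indecomposable (hne a),
    ⟨c.iso (UpsetChart.directSum U c.isUpperSet id Function.injective_id fun i _ => ⟨i, rfl⟩)⟩⟩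

theorem hasMatching_of_pruning_isInfRefinement {A B : Type u} [Fintype A] [Fintype B]
    {U : A → Set (RPow d)} {V : B → Set (RPow d)} (cM : UpsetChart M U) (cN : UpsetChart N V)
    (hU : ∀ a, (U a).Nonempty) (hV : ∀ b, (V b).Nonempty) {n : ℕ} (hn : Fintype.card A ≤ n + 1)
    {ε : ℝ≥0} (h : IsInfRefinement (pruning (ε + 0) M) (pruning 0 N))
    (h' : IsInfRefinement (pruning (ε + 0) N) (pruning 0 M)) :
    HasMatching ((2 * n + 1) * ε) M N := by
  obtain ⟨σ, hσ, hs⟩ := exists_injective_of_pruning_isInfRefinement cM cN hU hV h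
  obtain ⟨τ, hτ, ht⟩ := exists_injective_of_pruning_isInfRefinement cN cM hV hU h'
  have hcard : Fintype.card A = Fintype.card B :=
    le_antisymm (Fintype.card_le_of_injective σ hσ) (Fintype.card_le_of_injective τ hτ)
  let e : A ≃ B := Equiv.ofBijective σ ((Fintype.bijective_iff_injective_and_card σ).2 ⟨hσ, hcard⟩)
  refine ⟨A, B, _, _, cM.isBarcode hU, cN.isBarcode hV, Set.univ, Set.univ,
    (Equiv.Set.univ A).trans (e.trans (Equiv.Set.univ B).symm), fun a => ?_,
    fun a ha => absurd (Set.mem_univ a) ha, fun b hb => absurd (Set.mem_univ b) hb⟩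
  refine interleaved_upsetModule _ _ ?_ ?_
  · have := subset_shift_matching cM.isUpperSet cN.isUpperSet hs hn a
    exact_mod_cast this
  · have := subset_shift_matching' cM.isUpperSet cN.isUpperSet hσ hτ hs ht hn a
    exact_mod_cast this

end PersMod

end

/-! ### The bound on the bottleneck distance -/

theorem mainTheorem1 {k : Type u} [Field k] {d : ℕ} (M N : PersMod k d)
    (hM : M.IsPFD) (hN : N.IsPFD)
    (hMU : M.IsUpsetDecomposable) (hNU : N.IsUpsetDecomposable)
    (r : ℕ) (hr : M.supdim = r) (hr1 : 1 ≤ r) (hNfin : N.supdim < ⊤) :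
    M.bottleneckDist N ≤ (2 * (r : ℝ≥0∞) - 1) * M.pruningDist N := by
  obtain ⟨n, rfl⟩ := Nat.exists_eq_add_of_le' hr1
  obtain ⟨s, hs⟩ := ENat.ne_top_iff_exists.1 hNfin.ne
  obtain ⟨A, _, U, hA, hU, ⟨cM⟩⟩ := PersMod.exists_upsetChart hMU hr.le
  obtain ⟨B, _, V, -, hV, ⟨cN⟩⟩ := PersMod.exists_upsetChart hNU hs.ge
  have hc : 2 * ((n + 1 : ℕ) : ℝ≥0∞) - 1 = ((2 * n + 1 : ℝ≥0) : ℝ≥0∞) := by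
    have h : 2 * ((n + 1 : ℕ) : ℝ≥0∞) = ((2 * n + 1 : ℝ≥0) : ℝ≥0∞) + 1 := by
      push_cast
      ring
    rw [h, ENNReal.add_sub_cancel_right ENNReal.one_ne_top]
  have hc0 : ((2 * n + 1 : ℝ≥0) : ℝ≥0∞) ≠ 0 := by
    rw [ENNReal.coe_ne_zero]
    positivity
  -- The factor is nonzero and finite, so it passes through the infima even when they are empty and
  -- equal to `∞`.
  rw [hc, PersMod.pruningDist, ENNReal.mul_iInf_of_ne hc0 ENNReal.coe_ne_top]
  refine le_iInf fun ε => ?_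
  rw [ENNReal.mul_iInf_of_ne hc0 ENNReal.coe_ne_top]
  refine le_iInf fun h => ?_
  rw [← ENNReal.coe_mul]
  exact iInf₂_le (f := fun (η : ℝ≥0) (_ : M.HasMatching η N) => (η : ℝ≥0∞)) _
    (PersMod.hasMatching_of_pruning_isInfRefinement cM cN hU hV hA (h 0).1 (h 0).2)
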